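/- Let $\mathbb K$ be $\mathbb R$ or $\mathbb C$. For a bounded linear operator $T:E\to F$ between normed spaces over $\mathbb K$, let the $2$-summing norm $\pi_2(T)\in[0,\infty]$ be the supremum of $\bigl(\sum_{i=1}^n\|TUe_i\|^2\bigr)^{1/2}$ over all $n\ge 1$ and all operators $U:\ell_2^n\to E$ with $\|U\|=1$, where $(e_i)$ is the unit vector basis of $\ell_2^n$ (the supremum of the empty set being $0$). The space $E$ has the $2$-summing property if $\pi_2(T)=\|T\|$ for every bounded linear operator $T:E\to\ell_2$. Let $K$ be a compact metric space and let $X$ be a finite-dimensional subspace of the space $C(K)$ of continuous $\mathbb K$-valued functions on $K$ with the supremum norm. (b) $X$ does not have the $2$-summing property if and only if there exist finitely many vectors $x_1,\dots,x_n\in X$ and a closed set $K_0\subset K$ with $$1_{K_0}\le\sum_{j=1}^n|x_j|^2\le 1\quad\text{pointwise on }K$$ such that for every $x\in X$ with $1_{K_0}\le|x|\le 1$ pointwise on $K$, the function $1_{K_0}x$ is not in $\operatorname{span}\{1_{K_0}x_1,\dots,1_{K_0}x_n\}$. (a) If $\dim X=2$, then $X$ does not have the $2$-summing property if and only if there exist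 $x_1,x_2\in X$ and a closed set $K_0\subset K$ with $1_{K_0}\le|x_1|^2+|x_2|^2\le1$ pointwise on $K$ such that no $x\in X$ with $\|x\|_\infty=1$ satisfies $|x(t)|=1$ for all $t\in K_0$. -/

import Mathlib

open scoped ENNReal

noncomputable section

/-- The 2-summing norm `π₂(T) ∈ [0, ∞]` of a bounded operator `T : E → F`: the supremum of
`(∑ i, ‖T U eᵢ‖²)^{1/2}` over all `n` and all norm one operators `U : ℓ₂ⁿ → E`, where `(eᵢ)` is the
unit vector basis of `ℓ₂ⁿ`. The operator `T` is 2-summing when this is finite. -/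
def twoSummingNorm {𝕜 E F : Type*} [RCLike 𝕜]
    [NormedAddCommGroup E] [NormedSpace 𝕜 E] [NormedAddCommGroup F] [NormedSpace 𝕜 F]
    (T : E →L[𝕜] F) : ℝ≥0∞ :=
  ⨆ (n : ℕ) (U : EuclideanSpace 𝕜 (Fin n) →L[𝕜] E) (_ : ‖U‖ = 1),
    ENNReal.ofReal (Real.sqrt (∑ i : Fin n, ‖T (U (EuclideanSpace.single i (1 : 𝕜)))‖ ^ 2))

/-- `E` has the 2-summing property over `𝕜` if `π₂(T) = ‖T‖` for every bounded `𝕜`-linear operator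
`T : E → ℓ₂`. -/
def TwoSummingProperty (𝕜 E : Type*) [RCLike 𝕜] [NormedAddCommGroup E] [NormedSpace 𝕜 E] : Prop :=
  ∀ T : E →L[𝕜] lp (fun _ : ℕ => 𝕜) 2, twoSummingNorm T = ENNReal.ofReal ‖T‖

end

open Finset

section TwoSumming

variable {𝕜 : Type*} [RCLike 𝕜]

/-! Norm-one operators `ℓ₂ⁿ → X` are tuples with square function at most one, so `π₂(T)²` is the
supremum of `∑ ‖T xⱼ‖²` over such tuples (`twoSummingProperty_iff`). Finite dimension makes it a
maximum (`exists_extremal_tuple`).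

Let `K₀` be the set where an extremal square function equals one. First-order perturbations of the
extremal tuple show that `T` kills every `w` vanishing on `K₀` (`map_eq_zero_of_extremal`), and that
`‖T z‖ ≥ π₂(T)` for each combination `z` of the `xⱼ` unimodular on `K₀`
(`le_norm_map_sum_of_extremal`). A `y` in the unit ball equal to such a `z` on `K₀` would then give
`‖T‖ ≥ ‖T y‖ = ‖T z‖ ≥ π₂(T)`.

Conversely (`TwoSummingProperty.exists_norm_eq_one`), sample on a dense sequence of `K₀` with
weights of total mass one, then project onto the span of the sampled `xⱼ`. The square sum is 1, so
the property yields `y` in the unit ball with image of norm at least 1. Equality throughout forces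
`|y| = 1` on `K₀` and puts `y` in the span there. -/

theorem sum_norm_sq_sub_smul_sum {H : Type*} [NormedAddCommGroup H] [InnerProductSpace 𝕜 H]
    {ι : Type*} [Fintype ι] (v : ι → H) (a : ι → 𝕜) (δ : ℝ) :
    ∑ j, ‖v j - ((δ : 𝕜) * starRingEnd 𝕜 (a j)) • ∑ i, a i • v i‖ ^ 2 =
      ∑ j, ‖v j‖ ^ 2 - (2 * δ - δ ^ 2 * ∑ j, ‖a j‖ ^ 2) * ‖∑ i, a i • v i‖ ^ 2 := by
  set z := ∑ i, a i • v i with hz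
  have h1 : ∑ j, RCLike.re (inner 𝕜 (v j) (((δ : 𝕜) * starRingEnd 𝕜 (a j)) • z)) =
      δ * ‖z‖ ^ 2 := by
    have : ∀ j, RCLike.re (inner 𝕜 (v j) (((δ : 𝕜) * starRingEnd 𝕜 (a j)) • z)) =
        δ * RCLike.re (inner 𝕜 (a j • v j) z) := by
      intro j
      rw [inner_smul_right, inner_smul_left, mul_assoc, RCLike.re_ofReal_mul]
    simp_rw [this]
    rw [← mul_sum, ← map_sum, ← sum_inner, ← hz, inner_self_eq_norm_sq]
  have h2 : ∀ j, ‖v j - ((δ : 𝕜) * starRingEnd 𝕜 (a j)) • z‖ ^ 2 =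
      ‖v j‖ ^ 2 - 2 * RCLike.re (inner 𝕜 (v j) (((δ : 𝕜) * starRingEnd 𝕜 (a j)) • z)) +
        ‖a j‖ ^ 2 * (δ ^ 2 * ‖z‖ ^ 2) := by
    intro j
    rw [norm_sub_sq (𝕜 := 𝕜), norm_smul, norm_mul, RCLike.norm_conj, RCLike.norm_ofReal]
    rw [mul_pow, mul_pow, sq_abs]
    ring
  simp_rw [h2]
  rw [sum_add_distrib, sum_sub_distrib, ← mul_sum, h1, ← sum_mul]
  ring

theorem sum_norm_sq_mulVec {H : Type*} [NormedAddCommGroup H] [InnerProductSpace 𝕜 H]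
    {ι κ : Type*} [Fintype ι] [Fintype κ] (A : Matrix ι κ 𝕜) (v : κ → H) :
    ((∑ j, ‖∑ i, A j i • v i‖ ^ 2 : ℝ) : 𝕜) =
      ∑ i, ∑ k, (A.conjTranspose * A) i k * inner 𝕜 (v i) (v k) := by
  push_cast
  simp_rw [← inner_self_eq_norm_sq_to_K (𝕜 := 𝕜), sum_inner, inner_sum, inner_smul_left,
    inner_smul_right, Matrix.mul_apply, Matrix.conjTranspose_apply, sum_mul]
  rw [sum_comm]
  refine sum_congr rfl fun i _ => ?_
  rw [sum_comm]
  refine sum_congr rfl fun k _ => sum_congr rfl fun j _ => ?_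
  rw [mul_assoc]; rfl

open scoped ComplexOrder MatrixOrder in
-- The Gram matrix is positive semidefinite, hence has a square factor. This shortens tuples to
-- length `dim X`.
theorem exists_square_conjTranspose_mul_self_eq {ι κ : Type*} [Fintype ι] [Fintype κ]
    [DecidableEq κ] (A : Matrix ι κ 𝕜) :
    ∃ B : Matrix κ κ 𝕜, B.conjTranspose * B = A.conjTranspose * A := by
  have h := (Matrix.posSemidef_conjTranspose_mul_self A).nonneg
  obtain ⟨B, hB⟩ := CStarAlgebra.nonneg_iff_eq_star_mul_self.1 h
  exact ⟨B, hB.symm⟩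

/-- First order perturbation of a function with maximum at most one on a compact space. -/
theorem exists_forall_add_mul_le {K : Type*} [TopologicalSpace K] [CompactSpace K] {p h : K → ℝ}
    (hp : Continuous p) (hh : Continuous h) (hp1 : ∀ t, p t ≤ 1) (hph : ∀ t, p t = 1 → h t ≤ 0)
    {η : ℝ} (hη : 0 < η) :
    ∃ ε₀ > 0, ∀ ε, 0 ≤ ε → ε ≤ ε₀ → ∀ t, p t + ε * h t ≤ 1 + ε * η := by
  have hc : IsCompact {t | η ≤ h t} := (isClosed_le continuous_const hh).isCompact
  rcases Set.eq_empty_or_nonempty {t | η ≤ h t} with he | hne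
  · refine ⟨1, one_pos, fun ε hε _ t => ?_⟩
    have : h t < η := by
      by_contra hcon
      exact Set.eq_empty_iff_forall_notMem.1 he t (not_lt.1 hcon)
    nlinarith [hp1 t]
  · obtain ⟨s, hs, hsmax⟩ := hc.exists_isMaxOn hne hp.continuousOn
    obtain ⟨r, hr, hrmax⟩ := hc.exists_isMaxOn hne hh.continuousOn
    have hs1 : p s < 1 := lt_of_le_of_ne (hp1 s) fun h1 => by
      have := hph s h1
      have : η ≤ h s := hs
      linarith
    have hr0 : 0 < h r := hη.trans_le hr
    refine ⟨(1 - p s) / h r, div_pos (by linarith) hr0, fun ε hε hε' t => ?_⟩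
    rcases lt_or_ge (h t) η with ht | ht
    · nlinarith [hp1 t]
    · have h1 : p t ≤ p s := hsmax ht
      have h2 : h t ≤ h r := hrmax ht
      have h3 : ε * h r ≤ 1 - p s := (le_div_iff₀ hr0).1 hε'
      nlinarith [mul_le_mul_of_nonneg_left h2 hε, mul_nonneg hε hη.le]

/-! ### Tuples with square function at most one, and the 2-summing norm -/

section ContinuousFunctions

variable {K : Type*} [TopologicalSpace K] [CompactSpace K] {X : Submodule 𝕜 C(K, 𝕜)}

/-- Testing `U` on the conjugated values at `t` gives a vector of norm `√S` whose image at `t` is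
`S`, so `S ≤ √S`. -/
theorem sum_norm_sq_apply_single_le_one {n : ℕ} (U : EuclideanSpace 𝕜 (Fin n) →L[𝕜] X)
    (hU : ‖U‖ ≤ 1) (t : K) :
    ∑ i, ‖(U (EuclideanSpace.single i 1) : C(K, 𝕜)) t‖ ^ 2 ≤ 1 := by
  set S := ∑ i, ‖(U (EuclideanSpace.single i 1) : C(K, 𝕜)) t‖ ^ 2 with hS
  set a : EuclideanSpace 𝕜 (Fin n) :=
    WithLp.toLp 2 fun i => starRingEnd 𝕜 ((U (EuclideanSpace.single i 1) : C(K, 𝕜)) t) with ha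
  have hna : ‖a‖ ^ 2 = S := by
    rw [EuclideanSpace.norm_sq_eq, hS]
    simp [ha]
  have hdec : a = ∑ i, a i • EuclideanSpace.single i (1 : 𝕜) := by
    ext j
    simp [Finset.sum_apply, Pi.single_apply]
  have hUa : (U a : C(K, 𝕜)) t = (S : 𝕜) := by
    rw [hdec, map_sum]
    simp only [map_smul, Submodule.coe_sum, Submodule.coe_smul, ContinuousMap.coe_sum,
      Finset.sum_apply, ContinuousMap.coe_smul, Pi.smul_apply, smul_eq_mul]
    rw [hS]
    push_cast
    refine sum_congr rfl fun i _ => ?_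
    simp only [ha]
    rw [RCLike.conj_mul]
  have hS0 : 0 ≤ S := sum_nonneg fun i _ => by positivity
  have h1 : S ≤ ‖a‖ := by
    have h2 : ‖(U a : C(K, 𝕜)) t‖ ≤ ‖U a‖ := (U a : C(K, 𝕜)).norm_coe_le_norm t
    rw [hUa, RCLike.norm_ofReal, abs_of_nonneg hS0] at h2
    exact h2.trans ((U.le_of_opNorm_le hU a).trans (one_mul _).le)
  have : S ^ 2 ≤ S := by
    rw [← hna] at h1 ⊢
    nlinarith [norm_nonneg a, sq_nonneg (‖a‖)]
  nlinarith

/-- The operator `ℓ₂ⁿ → E` taking the unit vectors to the given vectors. -/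
noncomputable def operatorOfTuple {E : Type*} [NormedAddCommGroup E] [NormedSpace 𝕜 E] {n : ℕ}
    (x : Fin n → E) : EuclideanSpace 𝕜 (Fin n) →L[𝕜] E :=
  ∑ j, (EuclideanSpace.proj j : EuclideanSpace 𝕜 (Fin n) →L[𝕜] 𝕜).smulRight (x j)

theorem operatorOfTuple_apply {E : Type*} [NormedAddCommGroup E] [NormedSpace 𝕜 E] {n : ℕ}
    (x : Fin n → E) (a : EuclideanSpace 𝕜 (Fin n)) :
    operatorOfTuple x a = ∑ j, a j • x j := by
  simp [operatorOfTuple]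

theorem operatorOfTuple_single {E : Type*} [NormedAddCommGroup E] [NormedSpace 𝕜 E] {n : ℕ}
    (x : Fin n → E) (i : Fin n) :
    operatorOfTuple x (EuclideanSpace.single i (1 : 𝕜)) = x i := by
  simp [operatorOfTuple_apply]

theorem norm_operatorOfTuple_le_one {n : ℕ} {x : Fin n → X}
    (hx : ∀ t, ∑ j, ‖(x j : C(K, 𝕜)) t‖ ^ 2 ≤ 1) : ‖operatorOfTuple (𝕜 := 𝕜) x‖ ≤ 1 := by
  refine ContinuousLinearMap.opNorm_le_bound _ zero_le_one fun a => ?_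
  rw [one_mul]
  change ‖(operatorOfTuple x a : C(K, 𝕜))‖ ≤ ‖a‖
  refine (ContinuousMap.norm_le _ (norm_nonneg _)).2 fun t => ?_
  rw [operatorOfTuple_apply]
  simp only [Submodule.coe_sum, Submodule.coe_smul, ContinuousMap.coe_sum,
      Finset.sum_apply, ContinuousMap.coe_smul, Pi.smul_apply, smul_eq_mul]
  refine (sq_le_sq₀ (norm_nonneg _) (norm_nonneg _)).1 ?_
  calc ‖∑ j, a j * (x j : C(K, 𝕜)) t‖ ^ 2 ≤ (∑ j, ‖a j‖ * ‖(x j : C(K, 𝕜)) t‖) ^ 2 := by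
        gcongr
        refine (norm_sum_le _ _).trans (sum_le_sum fun j _ => (norm_mul _ _).le)
    _ ≤ (∑ j, ‖a j‖ ^ 2) * ∑ j, ‖(x j : C(K, 𝕜)) t‖ ^ 2 := sum_mul_sq_le_sq_mul_sq _ _ _
    _ ≤ (∑ j, ‖a j‖ ^ 2) * 1 := by gcongr; exact hx t
    _ = ‖a‖ ^ 2 := by rw [mul_one, EuclideanSpace.norm_sq_eq]

/-- The definition asks for `‖U‖ = 1`; a nonzero contraction is scaled up to norm one, which only
increases the sum. -/
theorem ofReal_sqrt_le_twoSummingNorm {F : Type*} [NormedAddCommGroup F] [NormedSpace 𝕜 F]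
    (T : X →L[𝕜] F) {n : ℕ} {x : Fin n → X}
    (hx : ∀ t, ∑ j, ‖(x j : C(K, 𝕜)) t‖ ^ 2 ≤ 1) :
    ENNReal.ofReal (Real.sqrt (∑ j, ‖T (x j)‖ ^ 2)) ≤ twoSummingNorm T := by
  set U := operatorOfTuple (𝕜 := 𝕜) x with hUdef
  have hU1 : ‖U‖ ≤ 1 := norm_operatorOfTuple_le_one hx
  rcases (norm_nonneg U).eq_or_lt with h0 | h0
  · have hU0 : U = 0 := norm_eq_zero.1 h0.symm
    have : ∀ j, x j = 0 := fun j => by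
      rw [← operatorOfTuple_single (𝕜 := 𝕜) x j, ← hUdef, hU0]; rfl
    simp [this]
  · set V := ((‖U‖⁻¹ : ℝ) : 𝕜) • U with hV
    have hVn : ‖V‖ = 1 := by
      rw [hV, norm_smul, RCLike.norm_ofReal, abs_of_nonneg (by positivity), inv_mul_cancel₀ h0.ne']
    have key : ENNReal.ofReal (Real.sqrt (∑ j, ‖T (x j)‖ ^ 2)) ≤
        ENNReal.ofReal (Real.sqrt (∑ i, ‖T (V (EuclideanSpace.single i (1 : 𝕜)))‖ ^ 2)) := by
      refine ENNReal.ofReal_le_ofReal (Real.sqrt_le_sqrt (sum_le_sum fun i _ => ?_))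
      have : T (V (EuclideanSpace.single i (1 : 𝕜))) = ((‖U‖⁻¹ : ℝ) : 𝕜) • T (x i) := by
        rw [hV, smul_apply, map_smul, hUdef, operatorOfTuple_single]
      rw [this, norm_smul, RCLike.norm_ofReal, abs_of_nonneg (by positivity)]
      gcongr
      exact le_mul_of_one_le_left (norm_nonneg _) ((one_le_inv₀ h0).2 hU1)
    exact key.trans (le_iSup_of_le n (le_iSup_of_le V (le_iSup_of_le hVn le_rfl)))

theorem twoSummingNorm_le_ofReal {F : Type*} [NormedAddCommGroup F] [NormedSpace 𝕜 F]
    (T : X →L[𝕜] F) {C : ℝ} (hC : 0 ≤ C)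
    (h : ∀ (n : ℕ) (x : Fin n → X), (∀ t, ∑ j, ‖(x j : C(K, 𝕜)) t‖ ^ 2 ≤ 1) →
      ∑ j, ‖T (x j)‖ ^ 2 ≤ C ^ 2) :
    twoSummingNorm T ≤ ENNReal.ofReal C := by
  refine iSup_le fun n => iSup_le fun U => iSup_le fun hU => ENNReal.ofReal_le_ofReal ?_
  exact (Real.sqrt_le_left hC).2 (h n _ (sum_norm_sq_apply_single_le_one U hU.le))

theorem ofReal_norm_le_twoSummingNorm {F : Type*} [NormedAddCommGroup F] [NormedSpace 𝕜 F]
    (T : X →L[𝕜] F) : ENNReal.ofReal ‖T‖ ≤ twoSummingNorm T := by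
  rcases eq_or_ne (twoSummingNorm T) ⊤ with htop | htop
  · simp [htop]
  rw [← ENNReal.ofReal_toReal htop]
  refine ENNReal.ofReal_le_ofReal
    (ContinuousLinearMap.opNorm_le_of_unit_norm ENNReal.toReal_nonneg fun v hv => ?_)
  have h := ofReal_sqrt_le_twoSummingNorm T (n := 1) (x := fun _ => v) fun t => by
    have h2 : ‖(v : C(K, 𝕜)) t‖ ≤ 1 := hv ▸ (v : C(K, 𝕜)).norm_coe_le_norm t
    simpa using h2
  rw [← ENNReal.ofReal_le_iff_le_toReal htop]
  simpa [Real.sqrt_sq] using h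

theorem twoSummingProperty_iff :
    TwoSummingProperty 𝕜 X ↔ ∀ (T : X →L[𝕜] lp (fun _ : ℕ => 𝕜) 2) (n : ℕ) (x : Fin n → X),
      (∀ t, ∑ j, ‖(x j : C(K, 𝕜)) t‖ ^ 2 ≤ 1) → ∑ j, ‖T (x j)‖ ^ 2 ≤ ‖T‖ ^ 2 := by
  refine ⟨fun H T n x hx => ?_, fun H T => ?_⟩
  · have h := ofReal_sqrt_le_twoSummingNorm T hx
    rw [H T, ENNReal.ofReal_le_ofReal_iff (norm_nonneg _)] at h
    exact (Real.sqrt_le_left (norm_nonneg _)).1 h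
  · exact (twoSummingNorm_le_ofReal T (norm_nonneg _) (H T)).antisymm
      (ofReal_norm_le_twoSummingNorm T)

/-- Every finite family may be replaced by one indexed by a basis without changing the square sums
under the operator `T` or under point evaluations. -/
theorem exists_fin_finrank_tuple [FiniteDimensional 𝕜 X] {H : Type*} [NormedAddCommGroup H]
    [InnerProductSpace 𝕜 H] (T : X →L[𝕜] H) {n : ℕ} (x : Fin n → X) :
    ∃ y : Fin (Module.finrank 𝕜 X) → X,
      (∀ t, ∑ j, ‖(y j : C(K, 𝕜)) t‖ ^ 2 = ∑ j, ‖(x j : C(K, 𝕜)) t‖ ^ 2) ∧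
      ∑ j, ‖T (y j)‖ ^ 2 = ∑ j, ‖T (x j)‖ ^ 2 := by
  let b := Module.finBasis 𝕜 X
  let A : Matrix (Fin n) (Fin (Module.finrank 𝕜 X)) 𝕜 := fun j i => b.repr (x j) i
  have hA : ∀ j, x j = ∑ i, A j i • b i := fun j => (b.sum_repr (x j)).symm
  -- Both square sums depend on the coefficients only through `Aᴴ A`.
  obtain ⟨B, hB⟩ := exists_square_conjTranspose_mul_self_eq A
  refine ⟨fun j => ∑ i, B j i • b i, fun t => ?_, ?_⟩
  · have h1 := sum_norm_sq_mulVec A fun i => (b i : C(K, 𝕜)) t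
    have h2 := sum_norm_sq_mulVec B fun i => (b i : C(K, 𝕜)) t
    rw [hB, ← h1, RCLike.ofReal_inj] at h2
    simp_rw [hA]
    simpa using h2
  · have h1 := sum_norm_sq_mulVec A fun i => T (b i)
    have h2 := sum_norm_sq_mulVec B fun i => T (b i)
    rw [hB, ← h1, RCLike.ofReal_inj] at h2
    simp_rw [hA]
    simpa using h2

/-- The supremum defining the 2-summing norm is attained by a tuple of length `dim X`. -/
theorem exists_extremal_tuple [FiniteDimensional 𝕜 X] {H : Type*} [NormedAddCommGroup H]
    [InnerProductSpace 𝕜 H] (T : X →L[𝕜] H) :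
    ∃ x : Fin (Module.finrank 𝕜 X) → X, (∀ t, ∑ j, ‖(x j : C(K, 𝕜)) t‖ ^ 2 ≤ 1) ∧
      ∀ (n : ℕ) (u : Fin n → X), (∀ t, ∑ j, ‖(u j : C(K, 𝕜)) t‖ ^ 2 ≤ 1) →
        ∑ j, ‖T (u j)‖ ^ 2 ≤ ∑ j, ‖T (x j)‖ ^ 2 := by
  let d := Module.finrank 𝕜 X
  let s : Set (Fin d → X) := {x | ∀ t, ∑ j, ‖(x j : C(K, 𝕜)) t‖ ^ 2 ≤ 1}
  have : ProperSpace (Fin d → X) := FiniteDimensional.proper 𝕜 _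
  have hclosed : IsClosed s := by
    have : s = ⋂ t, {x | ∑ j, ‖(x j : C(K, 𝕜)) t‖ ^ 2 ≤ 1} := by ext; simp [s]
    rw [this]
    refine isClosed_iInter fun t => isClosed_le ?_ continuous_const
    refine continuous_finsetSum _ fun j _ => (Continuous.norm ?_).pow 2
    exact (ContinuousEvalConst.continuous_eval_const t).comp
      (continuous_subtype_val.comp (continuous_apply j))
  have hsub : s ⊆ Metric.closedBall 0 1 := by
    intro x hx
    rw [mem_closedBall_zero_iff, pi_norm_le_iff_of_nonneg zero_le_one]
    intro j
    change ‖(x j : C(K, 𝕜))‖ ≤ 1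
    refine (ContinuousMap.norm_le _ zero_le_one).2 fun t => ?_
    have h1 : ‖(x j : C(K, 𝕜)) t‖ ^ 2 ≤ ∑ j, ‖(x j : C(K, 𝕜)) t‖ ^ 2 :=
      single_le_sum (f := fun j => ‖(x j : C(K, 𝕜)) t‖ ^ 2) (fun _ _ => by positivity) (mem_univ j)
    exact (sq_le_one_iff₀ (norm_nonneg _)).1 (h1.trans (hx t))
  have hcomp : IsCompact s := (isCompact_closedBall 0 1).of_isClosed_subset hclosed hsub
  obtain ⟨x, hx, hmax⟩ := hcomp.exists_isMaxOn ⟨0, fun t => by simp⟩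
    (f := fun x => ∑ j, ‖T (x j)‖ ^ 2) (by fun_prop)
  refine ⟨x, hx, fun n u hu => ?_⟩
  obtain ⟨y, hy1, hy2⟩ := exists_fin_finrank_tuple T u
  rw [← hy2]
  exact hmax fun t => (hy1 t).trans_le (hu t)

theorem sum_norm_sq_le_mul_of_forall_le {H : Type*} [NormedAddCommGroup H]
    [InnerProductSpace 𝕜 H] (T : X →L[𝕜] H) {m : ℝ}
    (hm : ∀ (n : ℕ) (u : Fin n → X), (∀ t, ∑ j, ‖(u j : C(K, 𝕜)) t‖ ^ 2 ≤ 1) →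
        ∑ j, ‖T (u j)‖ ^ 2 ≤ m) {n : ℕ} (u : Fin n → X) {c : ℝ} (hc : 0 < c)
    (hu : ∀ t, ∑ j, ‖(u j : C(K, 𝕜)) t‖ ^ 2 ≤ c) : ∑ j, ‖T (u j)‖ ^ 2 ≤ m * c := by
  have hs : ‖(((Real.sqrt c)⁻¹ : ℝ) : 𝕜)‖ ^ 2 = c⁻¹ := by
    rw [RCLike.norm_ofReal, sq_abs, inv_pow, Real.sq_sqrt hc.le]
  have h := hm n (fun j => (((Real.sqrt c)⁻¹ : ℝ) : 𝕜) • u j) fun t => by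
    simp only [Submodule.coe_smul, ContinuousMap.coe_smul, Pi.smul_apply, norm_smul, mul_pow, hs]
    rw [← mul_sum, inv_mul_le_iff₀ hc, mul_one]
    exact hu t
  simp only [map_smul, norm_smul, mul_pow, hs] at h
  rw [← mul_sum, inv_mul_le_iff₀ hc] at h
  linarith

end ContinuousFunctions

/-! ### First-order conditions at an extremal tuple -/

section Extremal

variable {K : Type*} [TopologicalSpace K] [CompactSpace K] {X : Submodule 𝕜 C(K, 𝕜)}
  {H : Type*} [NormedAddCommGroup H] [InnerProductSpace 𝕜 H]

/-- Adjoining `√ε • w` raises the supremum of the square function by only `o(ε)`, but the square sum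
under `T` by `ε ‖T w‖²`. -/
theorem map_eq_zero_of_extremal (T : X →L[𝕜] H) {d : ℕ} {x : Fin d → X}
    (hx : ∀ t, ∑ j, ‖(x j : C(K, 𝕜)) t‖ ^ 2 ≤ 1)
    (hmax : ∀ (n : ℕ) (u : Fin n → X), (∀ t, ∑ j, ‖(u j : C(K, 𝕜)) t‖ ^ 2 ≤ 1) →
        ∑ j, ‖T (u j)‖ ^ 2 ≤ ∑ j, ‖T (x j)‖ ^ 2)
    {w : X} (hw : ∀ t, ∑ j, ‖(x j : C(K, 𝕜)) t‖ ^ 2 = 1 → (w : C(K, 𝕜)) t = 0) : T w = 0 := by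
  set m := ∑ j, ‖T (x j)‖ ^ 2 with hm
  have hm0 : 0 ≤ m := sum_nonneg fun _ _ => by positivity
  have key : ∀ η > 0, ‖T w‖ ^ 2 ≤ m * η := by
    intro η hη
    obtain ⟨ε, hε, hle⟩ := exists_forall_add_mul_le
      (p := fun t => ∑ j, ‖(x j : C(K, 𝕜)) t‖ ^ 2) (h := fun t => ‖(w : C(K, 𝕜)) t‖ ^ 2)
      (by fun_prop) (by fun_prop) hx (fun t ht => by simp [hw t ht]) hη
    have hs : ‖((Real.sqrt ε : ℝ) : 𝕜)‖ ^ 2 = ε := by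
      rw [RCLike.norm_ofReal, sq_abs, Real.sq_sqrt hε.le]
    have h := sum_norm_sq_le_mul_of_forall_le T hmax
      (Fin.cons (((Real.sqrt ε : ℝ) : 𝕜) • w) x : Fin (d + 1) → X) (c := 1 + ε * η)
      (by positivity) fun t => by
        simp only [Fin.sum_univ_succ, Fin.cons_zero, Fin.cons_succ, Submodule.coe_smul,
          ContinuousMap.coe_smul, Pi.smul_apply, norm_smul, mul_pow, hs]
        linarith [hle ε hε.le le_rfl t]
    simp only [Fin.sum_univ_succ, Fin.cons_zero, Fin.cons_succ, map_smul, norm_smul, mul_pow,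
      hs] at h
    rw [← hm] at h
    have : ε * ‖T w‖ ^ 2 ≤ ε * (m * η) := by linarith
    exact le_of_mul_le_mul_left this hε
  have h0 : ‖T w‖ ^ 2 ≤ 0 := by
    refine le_of_forall_pos_le_add fun e he => ?_
    -- Dividing by `m + 1` covers the case `m = 0`.
    have h1 := key (e / (m + 1)) (by positivity)
    have : m * (e / (m + 1)) ≤ e := by
      rw [mul_div_assoc', div_le_iff₀ (by positivity)]
      nlinarith
    linarith
  exact norm_eq_zero.1 (pow_eq_zero_iff two_ne_zero |>.1 (h0.antisymm (by positivity)))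

/-- Subtracting `δ āⱼ z` from each `xⱼ` lowers the square function by `ε |z|²` and the square sum
under `T` by `ε ‖T z‖²`, with the same `ε = 2δ - δ² ∑ |aⱼ|²`. Since `|z| = 1` on the contact set,
the new supremum is at most `1 - ε + o(ε)`; compare with maximality. -/
theorem le_norm_map_sum_of_extremal (T : X →L[𝕜] H) {d : ℕ} {x : Fin d → X}
    (hx : ∀ t, ∑ j, ‖(x j : C(K, 𝕜)) t‖ ^ 2 ≤ 1)
    (hmax : ∀ (n : ℕ) (u : Fin n → X), (∀ t, ∑ j, ‖(u j : C(K, 𝕜)) t‖ ^ 2 ≤ 1) →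
        ∑ j, ‖T (u j)‖ ^ 2 ≤ ∑ j, ‖T (x j)‖ ^ 2)
    {a : Fin d → 𝕜} (ha : ∀ t, ∑ j, ‖(x j : C(K, 𝕜)) t‖ ^ 2 = 1 →
      ‖((∑ j, a j • x j : X) : C(K, 𝕜)) t‖ = 1) :
    ∑ j, ‖T (x j)‖ ^ 2 ≤ ‖T (∑ j, a j • x j)‖ ^ 2 := by
  set m := ∑ j, ‖T (x j)‖ ^ 2 with hm
  have hm0 : 0 ≤ m := sum_nonneg fun _ _ => by positivity
  set z : X := ∑ j, a j • x j with hz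
  have key : ∀ η, 0 < η → m * (1 - η) ≤ ‖T z‖ ^ 2 := by
    intro η hη
    obtain ⟨ε₀, hε₀, hle⟩ := exists_forall_add_mul_le
      (p := fun t => ∑ j, ‖(x j : C(K, 𝕜)) t‖ ^ 2) (h := fun t => 1 - ‖(z : C(K, 𝕜)) t‖ ^ 2)
      (by fun_prop) (by fun_prop) hx (fun t ht => by simp [ha t ht]) hη
    set N := ∑ j, ‖a j‖ ^ 2 with hN
    have hN0 : 0 ≤ N := sum_nonneg fun _ _ => by positivity
    -- The three bounds give `δ ≤ ε`, `ε ≤ ε₀`, and `ε < 1`, the last keeping the scaling constant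
    -- positive.
    obtain ⟨δ, hδ, hδN, hδε, hδ1⟩ : ∃ δ > 0, δ * N ≤ 1 ∧ 2 * δ ≤ ε₀ ∧ 2 * δ < 1 := by
      refine ⟨min (1 / (N + 1)) (min (ε₀ / 2) (1 / 4)), by positivity, ?_, ?_, ?_⟩
      · calc _ ≤ 1 / (N + 1) * N := by gcongr; exact min_le_left _ _
          _ ≤ 1 := by rw [div_mul_eq_mul_div, div_le_one (by positivity)]; linarith
      · linarith [(min_le_right (1 / (N + 1)) (min (ε₀ / 2) (1 / 4))).trans (min_le_left _ _)]
      · linarith [(min_le_right (1 / (N + 1)) (min (ε₀ / 2) (1 / 4))).trans (min_le_right _ _)]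
    set ε := 2 * δ - δ ^ 2 * N with hε
    have hε1 : δ ≤ ε := by nlinarith
    have hε2 : ε ≤ 2 * δ := by nlinarith [mul_nonneg (sq_nonneg δ) hN0]
    have hε0 : 0 < ε := hδ.trans_le hε1
    have h := sum_norm_sq_le_mul_of_forall_le T hmax
      (fun j => x j - ((δ : 𝕜) * starRingEnd 𝕜 (a j)) • z) (c := 1 - ε + ε * η)
      (by nlinarith [mul_pos hε0 hη]) fun t => by
        have h1 := sum_norm_sq_sub_smul_sum (fun j => (x j : C(K, 𝕜)) t) a δ
        have h2 : ∑ i, a i • (x i : C(K, 𝕜)) t = (z : C(K, 𝕜)) t := by simp [hz]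
        rw [h2, ← hN, ← hε] at h1
        have h3 := hle ε hε0.le (hε2.trans hδε) t
        simp only [Submodule.coe_sub, Submodule.coe_smul, ContinuousMap.coe_sub,
          ContinuousMap.coe_smul, Pi.sub_apply, Pi.smul_apply]
        rw [h1]
        linarith
    have h1 := sum_norm_sq_sub_smul_sum (fun j => T (x j)) a δ
    have h2 : ∑ i, a i • T (x i) = T z := by simp [hz]
    rw [h2, ← hN, ← hε] at h1
    simp only [map_sub, map_smul] at h
    rw [h1, ← hm] at h
    have : ε * (m * (1 - η)) ≤ ε * ‖T z‖ ^ 2 := by linarith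
    exact le_of_mul_le_mul_left this hε0
  refine le_of_forall_pos_le_add fun e he => ?_
  have h1 := key (e / (m + 1)) (by positivity)
  have : m * (e / (m + 1)) ≤ e := by
    rw [mul_div_assoc', div_le_iff₀ (by positivity)]
    nlinarith
  linarith

/-- If `X` fails the 2-summing property, then an extremal tuple for some operator, together with
the set where its square function equals one, witnesses the failure. -/
theorem exists_tuple_of_not_twoSummingProperty [FiniteDimensional 𝕜 X]
    (hX : ¬ TwoSummingProperty 𝕜 X) :
    ∃ x : Fin (Module.finrank 𝕜 X) → X, (∀ t, ∑ j, ‖(x j : C(K, 𝕜)) t‖ ^ 2 ≤ 1) ∧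
      ∀ y : X, ‖y‖ ≤ 1 →
        (∀ t, ∑ j, ‖(x j : C(K, 𝕜)) t‖ ^ 2 = 1 → ‖(y : C(K, 𝕜)) t‖ = 1) →
        ∀ a : Fin (Module.finrank 𝕜 X) → 𝕜, ¬ ∀ t, ∑ j, ‖(x j : C(K, 𝕜)) t‖ ^ 2 = 1 →
          (y : C(K, 𝕜)) t = ∑ j, a j * (x j : C(K, 𝕜)) t := by
  rw [twoSummingProperty_iff] at hX
  push Not at hX
  obtain ⟨T, n, u, hu, hT⟩ := hX
  obtain ⟨x, hx, hmax⟩ := exists_extremal_tuple T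
  refine ⟨x, hx, fun y hy hy1 a hya => ?_⟩
  have hz : ∀ t, ((∑ j, a j • x j : X) : C(K, 𝕜)) t = ∑ j, a j * (x j : C(K, 𝕜)) t :=
    fun t => by simp
  have h0 : T (y - ∑ j, a j • x j) = 0 := map_eq_zero_of_extremal T hx hmax fun t ht => by
    rw [Submodule.coe_sub, ContinuousMap.sub_apply, hz, hya t ht, sub_self]
  have h1 := le_norm_map_sum_of_extremal T hx hmax (a := a) fun t ht => by
    rw [hz, ← hya t ht, hy1 t ht]
  rw [map_sub, sub_eq_zero] at h0
  rw [← h0] at h1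
  have h2 : ‖T y‖ ≤ ‖T‖ := (T.le_opNorm y).trans (mul_le_of_le_one_right (norm_nonneg _) hy)
  have h3 : ‖T y‖ ^ 2 ≤ ‖T‖ ^ 2 := by gcongr
  linarith [hmax n u hu]

end Extremal

/-! ### Sampling operators and the converse -/

section Converse

variable {K : Type*} [TopologicalSpace K] [CompactSpace K] {X : Submodule 𝕜 C(K, 𝕜)}

theorem lp_two_hasSum_norm_sq (f : lp (fun _ : ℕ => 𝕜) 2) :
    HasSum (fun k => ‖f k‖ ^ 2) (‖f‖ ^ 2) := by
  have h := lp.hasSum_norm (p := 2) (by norm_num) f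
  simpa using h

/-- Sampling along a sequence with square weights `1/2, 1/4, …`. -/
theorem exists_sampling [FiniteDimensional 𝕜 X] (τ : ℕ → K) :
    ∃ S : X →L[𝕜] lp (fun _ : ℕ => 𝕜) 2,
      ∀ x k, S x k = ((Real.sqrt (1 / 2 / 2 ^ k) : ℝ) : 𝕜) * (x : C(K, 𝕜)) (τ k) := by
  have hmem : ∀ x : X,
      Memℓp (fun k : ℕ => ((Real.sqrt (1 / 2 / 2 ^ k) : ℝ) : 𝕜) * (x : C(K, 𝕜)) (τ k)) 2 := by
    intro x
    refine memℓp_gen ?_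
    refine Summable.of_nonneg_of_le (fun k => by positivity) (fun k => ?_)
      ((hasSum_geometric_two' 1).summable.mul_right (‖x‖ ^ 2))
    have h2 : ‖(x : C(K, 𝕜)) (τ k)‖ ≤ ‖x‖ := (x : C(K, 𝕜)).norm_coe_le_norm _
    rw [ENNReal.toReal_ofNat, Real.rpow_two, norm_mul, mul_pow, RCLike.norm_ofReal, sq_abs,
      Real.sq_sqrt (by positivity)]
    gcongr
  let S : X →ₗ[𝕜] lp (fun _ : ℕ => 𝕜) 2 :=
    { toFun := fun x => ⟨_, hmem x⟩
      map_add' := fun x y => by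
        ext k
        exact mul_add _ _ _
      map_smul' := fun c x => by
        ext k
        simp [mul_left_comm] }
  exact ⟨LinearMap.toContinuousLinearMap S, fun x k => rfl⟩

theorem exists_norm_eq_opNorm [FiniteDimensional 𝕜 X] {F : Type*} [NormedAddCommGroup F]
    [NormedSpace 𝕜 F] (T : X →L[𝕜] F) : ∃ y : X, ‖y‖ ≤ 1 ∧ ‖T‖ ≤ ‖T y‖ := by
  have : ProperSpace X := FiniteDimensional.proper 𝕜 _
  obtain ⟨y, hy, hmax⟩ := (isCompact_closedBall (0 : X) 1).exists_isMaxOn ⟨0, by simp⟩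
    (f := fun x => ‖T x‖) (by fun_prop)
  refine ⟨y, by simpa using hy, ContinuousLinearMap.opNorm_le_of_unit_norm (norm_nonneg _)
    fun v hv => hmax (by simp [hv])⟩

/-- If `X` has the 2-summing property, every square function equal to one on `K₀` is matched by a
function in `X` of modulus one on `K₀`, agreeing there with a linear combination. -/
theorem TwoSummingProperty.exists_norm_eq_one [SecondCountableTopology K] [FiniteDimensional 𝕜 X]
    (hX : TwoSummingProperty 𝕜 X) {n : ℕ} {x : Fin n → X} {K₀ : Set K}
    (hx : ∀ t, ∑ j, ‖(x j : C(K, 𝕜)) t‖ ^ 2 ≤ 1)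
    (hx₀ : ∀ t ∈ K₀, ∑ j, ‖(x j : C(K, 𝕜)) t‖ ^ 2 = 1) :
    ∃ y : X, ‖y‖ ≤ 1 ∧ (∀ t ∈ K₀, ‖(y : C(K, 𝕜)) t‖ = 1) ∧
      ∃ a : Fin n → 𝕜, ∀ t ∈ K₀, (y : C(K, 𝕜)) t = ∑ j, a j * (x j : C(K, 𝕜)) t := by
  rcases K₀.eq_empty_or_nonempty with rfl | hne
  · exact ⟨0, by simp, by simp, 0, by simp⟩
  have : Nonempty K₀ := hne.to_subtype
  let τ : ℕ → K := fun k => (TopologicalSpace.denseSeq K₀ k : K)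
  have hτ : ∀ k, τ k ∈ K₀ := fun k => (TopologicalSpace.denseSeq K₀ k).2
  have hdense : ∀ f g : C(K, 𝕜), (∀ k, f (τ k) = g (τ k)) → ∀ t ∈ K₀, f t = g t := by
    intro f g hfg t ht
    have h := (TopologicalSpace.denseRange_denseSeq K₀).equalizer
      (f.continuous.comp continuous_subtype_val) (g.continuous.comp continuous_subtype_val)
      (funext hfg)
    exact congrFun h ⟨t, ht⟩
  obtain ⟨S, hS⟩ := exists_sampling (X := X) τ
  have hSsq : ∀ v k, ‖S v k‖ ^ 2 = 1 / 2 / 2 ^ k * ‖(v : C(K, 𝕜)) (τ k)‖ ^ 2 := by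
    intro v k
    rw [hS, norm_mul, mul_pow, RCLike.norm_ofReal, sq_abs, Real.sq_sqrt (by positivity)]
  let W : Submodule 𝕜 (lp (fun _ : ℕ => 𝕜) 2) := Submodule.span 𝕜 (Set.range fun j => S (x j))
  have : FiniteDimensional 𝕜 W := FiniteDimensional.span_of_finite 𝕜 (Set.finite_range _)
  -- Projecting keeps each `S (x j)` and makes norm equality detect membership in `W`.
  let T : X →L[𝕜] lp (fun _ : ℕ => 𝕜) 2 := W.starProjection ∘L S
  have hTx : ∀ j, T (x j) = S (x j) := fun j =>
    Submodule.starProjection_eq_self_iff.2 (Submodule.subset_span ⟨j, rfl⟩)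
  have hsum : ∑ j, ‖S (x j)‖ ^ 2 = 1 := by
    have h1 : HasSum (fun k => ∑ j, ‖S (x j) k‖ ^ 2) (∑ j, ‖S (x j)‖ ^ 2) :=
      hasSum_sum fun j _ => lp_two_hasSum_norm_sq (S (x j))
    have h2 : (fun k => ∑ j, ‖S (x j) k‖ ^ 2) = fun k : ℕ => (1 : ℝ) / 2 / 2 ^ k := by
      funext k
      simp_rw [hSsq]
      rw [← mul_sum, hx₀ _ (hτ k), mul_one]
    rw [h2] at h1
    exact h1.unique (hasSum_geometric_two' 1)
  obtain ⟨y, hy, hTy⟩ := exists_norm_eq_opNorm T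
  have hT1 : 1 ≤ ‖T‖ := by
    have h := twoSummingProperty_iff.1 hX T n x hx
    simp_rw [hTx] at h
    rw [hsum] at h
    exact (one_le_sq_iff₀ T.opNorm_nonneg).1 h
  have hyle : ∀ t, ‖(y : C(K, 𝕜)) t‖ ≤ 1 := fun t =>
    ((y : C(K, 𝕜)).norm_coe_le_norm t).trans hy
  have hterm : ∀ k, ‖S y k‖ ^ 2 ≤ 1 / 2 / 2 ^ k := fun k => by
    rw [hSsq]
    exact mul_le_of_le_one_right (by positivity) (pow_le_one₀ (norm_nonneg _) (hyle _))
  have hSy : ‖S y‖ ≤ 1 := by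
    rw [← sq_le_one_iff₀ (norm_nonneg _)]
    exact hasSum_le hterm (lp_two_hasSum_norm_sq _) (hasSum_geometric_two' 1)
  have hproj : ‖T y‖ ≤ ‖S y‖ := W.norm_starProjection_apply_le (S y)
  have hSy1 : ‖S y‖ = 1 := hSy.antisymm (hT1.trans (hTy.trans hproj))
  have hmem : S y ∈ W :=
    (W.mem_iff_norm_starProjection _).2 (hproj.antisymm (hSy.trans (hT1.trans hTy)))
  -- All weights are positive, so one sample below modulus one would make `‖S y‖ < 1`.
  have hone : ∀ k, ‖(y : C(K, 𝕜)) (τ k)‖ = 1 := by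
    intro k
    by_contra hk
    have hlt : ‖(y : C(K, 𝕜)) (τ k)‖ ^ 2 < 1 :=
      pow_lt_one₀ (norm_nonneg _) (lt_of_le_of_ne (hyle _) hk) two_ne_zero
    have hlt' : ‖S y k‖ ^ 2 < 1 / 2 / 2 ^ k := by
      rw [hSsq]
      exact mul_lt_of_lt_one_right (by positivity) hlt
    have h := hasSum_lt hterm hlt' (lp_two_hasSum_norm_sq _) (hasSum_geometric_two' 1)
    rw [hSy1] at h
    norm_num at h
  obtain ⟨a, ha⟩ := (Submodule.mem_span_range_iff_exists_fun 𝕜).1 hmem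
  refine ⟨y, hy, fun t ht => ?_, a, fun t ht => ?_⟩
  · have h := hdense ⟨fun t => ((‖(y : C(K, 𝕜)) t‖ : ℝ) : 𝕜), by fun_prop⟩ 1
      (fun k => by simp [hone k]) t ht
    have h' : ((‖(y : C(K, 𝕜)) t‖ : ℝ) : 𝕜) = 1 := h
    exact_mod_cast h'
  · have h := hdense y ((∑ j, a j • x j : X) : C(K, 𝕜)) (fun k => ?_) t ht
    · simpa using h
    have hc : ((Real.sqrt (1 / 2 / 2 ^ k) : ℝ) : 𝕜) ≠ 0 := by
      rw [Ne, RCLike.ofReal_eq_zero]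
      positivity
    have hk : S (∑ j, a j • x j) k = S y k := by
      rw [← ha]
      simp
    rw [hS, hS] at hk
    exact (mul_left_cancel₀ hc hk).symm

end Converse

theorem indicator_mem_span_range_iff {K : Type*} [TopologicalSpace K] {n : ℕ}
    {x : Fin n → C(K, 𝕜)} {y : C(K, 𝕜)} {K₀ : Set K} :
    K₀.indicator (y : K → 𝕜) ∈
        Submodule.span 𝕜 (Set.range fun j => K₀.indicator (x j : K → 𝕜)) ↔
      ∃ a : Fin n → 𝕜, ∀ t ∈ K₀, y t = ∑ j, a j * x j t := by
  rw [Submodule.mem_span_range_iff_exists_fun]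
  refine exists_congr fun a => ⟨fun h t ht => ?_, fun h => funext fun t => ?_⟩
  · have := congrFun h t
    simpa [ht, Finset.sum_apply] using this.symm
  · by_cases ht : t ∈ K₀
    · simp [ht, Finset.sum_apply, h t ht]
    · simp [ht, Finset.sum_apply]

theorem indicator_one_le_iff {K : Type*} {K₀ : Set K} {c : ℝ} (hc : 0 ≤ c) {t : K} :
    K₀.indicator (fun _ => (1 : ℝ)) t ≤ c ↔ (t ∈ K₀ → 1 ≤ c) := by
  by_cases ht : t ∈ K₀ <;> simp [ht, hc]

/-! ### Witnesses of failure, general and two-dimensional -/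

section Characterization

variable {K : Type*} [MetricSpace K] [CompactSpace K] {X : Submodule 𝕜 C(K, 𝕜)}
  [FiniteDimensional 𝕜 X]

theorem not_twoSummingProperty_of_tuple {n : ℕ} {x : Fin n → C(K, 𝕜)} {K₀ : Set K}
    (hxX : ∀ j, x j ∈ X)
    (hx : ∀ t : K, K₀.indicator (fun _ => (1 : ℝ)) t ≤ ∑ j, ‖x j t‖ ^ 2 ∧ ∑ j, ‖x j t‖ ^ 2 ≤ 1)
    (h : ∀ y ∈ X, (∀ t : K, K₀.indicator (fun _ => (1 : ℝ)) t ≤ ‖y t‖ ∧ ‖y t‖ ≤ 1) →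
      K₀.indicator (y : K → 𝕜) ∉
        Submodule.span 𝕜 (Set.range fun j => K₀.indicator (x j : K → 𝕜))) :
    ¬ TwoSummingProperty 𝕜 X := by
  intro hX
  obtain ⟨y, hy, hy1, ha⟩ := hX.exists_norm_eq_one (x := fun j => ⟨x j, hxX j⟩) (K₀ := K₀)
    (fun t => (hx t).2) fun t ht => (hx t).2.antisymm
      ((indicator_one_le_iff (sum_nonneg fun _ _ => by positivity)).1 (hx t).1 ht)
  refine h y y.2 (fun t => ⟨(indicator_one_le_iff (norm_nonneg _)).2 fun ht => (hy1 t ht).ge, ?_⟩)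
    (indicator_mem_span_range_iff.2 ha)
  exact ((y : C(K, 𝕜)).norm_coe_le_norm t).trans hy

theorem exists_pair_of_not_twoSummingProperty (hd : Module.finrank 𝕜 X = 2)
    (hX : ¬ TwoSummingProperty 𝕜 X) :
    ∃ x : Fin 2 → X, (∀ t, ∑ j, ‖(x j : C(K, 𝕜)) t‖ ^ 2 ≤ 1) ∧
      ∀ y : X, ‖y‖ = 1 →
        ¬ ∀ t, ∑ j, ‖(x j : C(K, 𝕜)) t‖ ^ 2 = 1 → ‖(y : C(K, 𝕜)) t‖ = 1 := by
  have h := exists_tuple_of_not_twoSummingProperty hX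
  rw [hd] at h
  obtain ⟨x, hx, h⟩ := h
  refine ⟨x, hx, fun y hy hy1 => ?_⟩
  -- An independent pair spans `X`, making the span condition automatic. For a dependent pair, one
  -- vector of its span has the same square function and contradicts `h`.
  by_cases hli : LinearIndependent 𝕜 x
  · have hspan := hli.span_eq_top_of_card_eq_finrank' (by simp [hd])
    obtain ⟨a, ha⟩ := (Submodule.mem_span_range_iff_exists_fun 𝕜).1
      (hspan ▸ Submodule.mem_top : y ∈ Submodule.span 𝕜 (Set.range x))
    exact h y hy.le hy1 a fun t _ => by simp [← ha]
  · obtain ⟨a, ha⟩ : ∃ a : Fin 2 → 𝕜, ∀ t,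
        ‖((∑ j, a j • x j : X) : C(K, 𝕜)) t‖ ^ 2 = ∑ j, ‖(x j : C(K, 𝕜)) t‖ ^ 2 := by
      rw [linearIndependent_fin2, not_and_or] at hli
      push Not at hli
      rcases hli with h1 | ⟨c, hc⟩
      · exact ⟨![1, 0], fun t => by simp [h1]⟩
      · refine ⟨![0, ((Real.sqrt (1 + ‖c‖ ^ 2) : ℝ) : 𝕜)], fun t => ?_⟩
        simp only [Fin.sum_univ_two, ← hc, Matrix.cons_val_zero, Matrix.cons_val_one, zero_smul,
          zero_add, Submodule.coe_smul, ContinuousMap.coe_smul, Pi.smul_apply, norm_smul, mul_pow,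
          RCLike.norm_ofReal, sq_abs]
        rw [Real.sq_sqrt (by positivity)]
        ring
    refine h (∑ j, a j • x j) ?_ (fun t ht => ?_) a fun t _ => by simp
    · refine (ContinuousMap.norm_le _ zero_le_one).2 fun t => ?_
      rw [← sq_le_one_iff₀ (norm_nonneg _)]
      exact (ha t).trans_le (hx t)
    · rw [← pow_eq_one_iff_of_nonneg (norm_nonneg _) two_ne_zero, ha t, ht]

end Characterization

end TwoSumming

theorem corollary2p7 {𝕜 : Type*} [RCLike 𝕜] {K : Type*} [MetricSpace K] [CompactSpace K]
    (X : Submodule 𝕜 C(K, 𝕜)) [FiniteDimensional 𝕜 X] :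
    -- the general finite-dimensional case
    (¬ TwoSummingProperty 𝕜 X ↔
      ∃ (n : ℕ) (x : Fin n → C(K, 𝕜)) (K₀ : Set K),
        (∀ j, x j ∈ X) ∧ IsClosed K₀ ∧
        (∀ t : K, K₀.indicator (fun _ => (1 : ℝ)) t ≤ ∑ j, ‖x j t‖ ^ 2 ∧
          ∑ j, ‖x j t‖ ^ 2 ≤ 1) ∧
        ∀ y ∈ X, (∀ t : K, K₀.indicator (fun _ => (1 : ℝ)) t ≤ ‖y t‖ ∧ ‖y t‖ ≤ 1) →
          K₀.indicator (y : K → 𝕜) ∉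
            Submodule.span 𝕜 (Set.range fun j => K₀.indicator (x j : K → 𝕜))) ∧
    -- the two-dimensional case
    (Module.finrank 𝕜 X = 2 →
      (¬ TwoSummingProperty 𝕜 X ↔
        ∃ x₁ ∈ X, ∃ x₂ ∈ X, ∃ K₀ : Set K, IsClosed K₀ ∧
          (∀ t : K, K₀.indicator (fun _ => (1 : ℝ)) t ≤ ‖x₁ t‖ ^ 2 + ‖x₂ t‖ ^ 2 ∧
            ‖x₁ t‖ ^ 2 + ‖x₂ t‖ ^ 2 ≤ 1) ∧
          ∀ y ∈ X, ‖y‖ = 1 → ¬ ∀ t ∈ K₀, ‖y t‖ = 1)) := by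
  refine ⟨⟨fun hX => ?_, fun ⟨n, x, K₀, hxX, _, hx, h⟩ =>
    not_twoSummingProperty_of_tuple hxX hx h⟩, fun hd => ⟨fun hX => ?_, ?_⟩⟩
  · obtain ⟨x, hx, h⟩ := exists_tuple_of_not_twoSummingProperty hX
    refine ⟨_, fun j => x j, {t | ∑ j, ‖(x j : C(K, 𝕜)) t‖ ^ 2 = 1}, fun j => (x j).2,
      isClosed_eq (by fun_prop) continuous_const, fun t => ⟨?_, hx t⟩, fun y hyX hy hspan => ?_⟩
    · exact (indicator_one_le_iff (sum_nonneg fun _ _ => by positivity)).2 fun ht => ht.ge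
    · obtain ⟨a, ha⟩ := indicator_mem_span_range_iff.1 hspan
      refine h ⟨y, hyX⟩ ?_ (fun t ht => ?_) a ha
      · exact (ContinuousMap.norm_le _ zero_le_one).2 fun t => (hy t).2
      · exact (hy t).2.antisymm ((indicator_one_le_iff (norm_nonneg _)).1 (hy t).1 ht)
  · obtain ⟨x, hx, h⟩ := exists_pair_of_not_twoSummingProperty hd hX
    simp only [Fin.sum_univ_two] at hx h
    refine ⟨x 0, (x 0).2, x 1, (x 1).2,
      {t | ‖(x 0 : C(K, 𝕜)) t‖ ^ 2 + ‖(x 1 : C(K, 𝕜)) t‖ ^ 2 = 1},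
      isClosed_eq (by fun_prop) continuous_const, fun t => ⟨?_, hx t⟩,
      fun y hyX hy hy1 => h ⟨y, hyX⟩ hy hy1⟩
    exact (indicator_one_le_iff (by positivity)).2 fun ht => ht.ge
  · rintro ⟨x₁, hx₁, x₂, hx₂, K₀, -, hx, h⟩
    have : Nontrivial X := Module.nontrivial_of_finrank_pos (R := 𝕜) (by omega)
    -- For empty `K₀` any normalized vector contradicts `h`. A point of `K₀` is needed below to get
    -- `‖y‖ = 1` rather than `‖y‖ ≤ 1`.
    have hne : K₀.Nonempty := by
      rw [Set.nonempty_iff_ne_empty]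
      rintro rfl
      obtain ⟨v, hv⟩ := exists_ne (0 : X)
      have hv' : ‖(v : C(K, 𝕜))‖ ≠ 0 := by simpa using hv
      refine h (((‖(v : C(K, 𝕜))‖⁻¹ : ℝ) : 𝕜) • (v : C(K, 𝕜))) (X.smul_mem _ v.2) ?_ (by simp)
      rw [norm_smul, RCLike.norm_ofReal, abs_of_nonneg (by positivity), inv_mul_cancel₀ hv']
    refine not_twoSummingProperty_of_tuple (x := ![x₁, x₂]) (K₀ := K₀) ?_ ?_ ?_
    · intro j
      fin_cases j <;> simpa
    · simpa [Fin.sum_univ_two] using hx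
    · intro y hyX hy _
      have hy1 : ∀ t ∈ K₀, ‖y t‖ = 1 := fun t ht =>
        (hy t).2.antisymm ((indicator_one_le_iff (norm_nonneg _)).1 (hy t).1 ht)
      obtain ⟨s, hs⟩ := hne
      refine h y hyX (le_antisymm ?_ ?_) hy1
      · exact (ContinuousMap.norm_le _ zero_le_one).2 fun t => (hy t).2
      · exact (hy1 s hs).symm.trans_le (y.norm_coe_le_norm s)
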